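/- Let $n\ge 1$ and $d\ge n+1$, and let $\mathbb{S}^d$ be the unit sphere centered at the origin of $\mathbb{R}^{d+1}$. Let $B_1,\dots,B_{n+2}\in\mathbb{S}^d$ be the vertices of a non-degenerate $(n+1)$-simplex, that is, they do not all lie in a common $(n+1)$-dimensional linear subspace of $\mathbb{R}^{d+1}$ (equivalently, in a common great $n$-sphere of $\mathbb{S}^d$). For $1\le i\le n+2$ let $F_i$ be the $n$-face opposite to $B_i$, that is, the spherical convex hull of the vertices $B_j$ with $j\ne i$, which is the set of points of $\mathbb{S}^d$ that are nonnegative linear combinations of these vertices. Then $$\sum_{i=1}^{n+2} V_n(F_i) < V_n(\mathbb{S}^n),$$ where $V_n(F_i)$ is the $n$-dimensional spherical volume (surface measure on the great $n$-sphere containing $F_i$), and $V_n(\mathbb{S}^n)$ is the total volume of the unit $n$-sphere. -/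

import Mathlib

open MeasureTheory
open scoped ENNReal

noncomputable section

/-- The spherical space `𝕊^d`: the unit sphere centred at the origin of `ℝ^(d+1)`. -/
abbrev SphericalSpace (d : ℕ) : Type :=
  Metric.sphere (0 : EuclideanSpace ℝ (Fin (d + 1))) 1

/-- Points of `𝕊^d`, the vertices of an `m`-simplex with `m + 1` vertices, form a *degenerate*
simplex if they are confined to a great sphere of dimension at most `m - 1`, i.e. to the
intersection of `𝕊^d` with a linear subspace of dimension at most `m`. -/
def IsDegenerateSphericalSimplex {d m : ℕ} (B : Fin (m + 1) → SphericalSpace d) : Prop :=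
  ∃ W : Submodule ℝ (EuclideanSpace ℝ (Fin (d + 1))),
    Module.finrank ℝ W ≤ m ∧ ∀ i, (B i : EuclideanSpace ℝ (Fin (d + 1))) ∈ W

/-- The region of `𝕊^d` spanned by the vertices `v`: the spherical convex hull of `v`, i.e. the
points of `𝕊^d` that are nonnegative linear combinations of the vertices. -/
def sphericalSimplex {d m : ℕ} (v : Fin (m + 1) → SphericalSpace d) : Set (SphericalSpace d) :=
  {x | ∃ c : Fin (m + 1) → ℝ, (∀ j, 0 ≤ c j) ∧
    (x : EuclideanSpace ℝ (Fin (d + 1))) = ∑ j, c j • (v j : EuclideanSpace ℝ (Fin (d + 1)))}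

/-- The `m`-dimensional volume of the (non-degenerate) spherical `m`-simplex with vertices
`v 0, …, v m`. The vertices span a linear subspace `W` of dimension `m + 1`, the simplex lies in the
great `m`-sphere `W ∩ 𝕊^d`, which is the unit sphere of `W`, and its volume is taken with respect to
the surface measure of that sphere (induced by the Lebesgue measure of the Euclidean space `W`). -/
def sphericalSimplexVolume {d m : ℕ} (v : Fin (m + 1) → SphericalSpace d) : ℝ≥0∞ :=
  let W : Submodule ℝ (EuclideanSpace ℝ (Fin (d + 1))) :=
    Submodule.span ℝ (Set.range fun j => (v j : EuclideanSpace ℝ (Fin (d + 1))))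
  (volume : Measure W).toSphere
    {x | ∃ y ∈ sphericalSimplex v, (y : EuclideanSpace ℝ (Fin (d + 1))) = (x : W)}

/-- The total volume `V_n(𝕊^n)` of the unit `n`-sphere, for its surface measure. -/
def unitSphereVolume (n : ℕ) : ℝ≥0∞ :=
  (volume : Measure (EuclideanSpace ℝ (Fin (n + 1)))).toSphere Set.univ

/-- The vertices of the `n`-face `F_i` of the `(n+1)`-simplex with vertices `B`: all vertices of `B`
except `B i`. -/
def faceVertices {d n : ℕ} (B : Fin (n + 1 + 1) → SphericalSpace d) (i : Fin (n + 1 + 1)) :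
    Fin (n + 1) → SphericalSpace d :=
  fun j => B (i.succAbove j)

end

/-! Let `V` be the `(n+2)`-dimensional span of the vertices. A random great circle of its unit
sphere, oriented from `x` to `y` for independent Gaussian `x, y`, almost surely enters the simplex
through at most one facet. It enters through `F_i` when `y_i x - x_i y`, in the coordinates of the
basis `B`, lies in the simplicial cone. That vector is uniform in direction on the hyperplane of
`F_i` (`stdGaussian_prod_hyperplane_section`), so the event has probability `V_n(F_i) / V_n(𝕊^n)`
(`toSphere_preimage_cone`). The events are almost disjoint, and an open set of pairs `(x, y)` avoids
them all, so the probabilities sum to less than one (`sum_stdGaussian_facets_lt_one`). -/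

open ProbabilityTheory Set
open scoped RealInnerProductSpace

/-! ### Gaussian measure and solid angle. -/

/-- The standard Gaussian measure has a positive density depending only on the norm. -/
theorem exists_stdGaussian_eq_withDensity_norm (E : Type*) [NormedAddCommGroup E]
    [InnerProductSpace ℝ E] [FiniteDimensional ℝ E] [MeasurableSpace E] [BorelSpace E] :
    ∃ g : ℝ → ℝ≥0∞, Measurable g ∧ (∀ r, g r ≠ 0) ∧
      stdGaussian E = (volume : Measure E).withDensity fun x => g ‖x‖ := by
  -- The normalizing constant: the integral of `exp (-‖x‖² / 2)`, namely `(2π)^(dim E / 2)`.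
  set c : ℝ := (Real.pi / (1 / 2)) ^ (Module.finrank ℝ E / 2 : ℝ) with hc
  have hc0 : 0 < c := by positivity
  have hint : Integrable (fun x : E => c⁻¹ * Real.exp (-(1 / 2) * ‖x‖ ^ 2)) := by
    have h := GaussianFourier.integrable_cexp_neg_mul_sq_norm_add (V := E) (b := 1 / 2)
      (by norm_num) 0 0
    refine (h.norm.congr (.of_forall fun x => ?_)).const_mul c⁻¹
    simp only [Complex.norm_exp]
    congr 1
    rw [zero_mul, add_zero]
    simp [← Complex.ofReal_pow]
  refine ⟨fun r => ENNReal.ofReal (c⁻¹ * Real.exp (-(1 / 2) * r ^ 2)), by fun_prop, fun r => ?_, ?_⟩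
  · have : 0 < c⁻¹ * Real.exp (-(1 / 2) * r ^ 2) := by positivity
    simpa using this
  have : IsFiniteMeasure ((volume : Measure E).withDensity fun x =>
      ENNReal.ofReal (c⁻¹ * Real.exp (-(1 / 2) * ‖x‖ ^ 2))) :=
    isFiniteMeasure_withDensity_ofReal hint.2
  refine Measure.ext_of_charFun (funext fun t => ?_)
  rw [charFun_stdGaussian, charFun_apply, integral_withDensity_eq_integral_toReal_smul
    (by fun_prop) (by simp)]
  have key := GaussianFourier.integral_cexp_neg_mul_sq_norm_add (V := E) (b := 1 / 2)
    (by norm_num) Complex.I t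
  have hfun : ∀ x : E, (ENNReal.ofReal (c⁻¹ * Real.exp (-(1 / 2) * ‖x‖ ^ 2))).toReal •
      Complex.exp (⟪x, t⟫ * Complex.I) =
      (c⁻¹ : ℂ) * Complex.exp (-(1 / 2) * ‖x‖ ^ 2 + Complex.I * ⟪t, x⟫) := by
    intro x
    rw [ENNReal.toReal_ofReal (by positivity), Complex.real_smul, Complex.exp_add,
      real_inner_comm x t, mul_comm Complex.I]
    push_cast
    ring
  simp_rw [hfun]
  rw [integral_const_mul, key]
  have hcc : ((Real.pi : ℂ) / (1 / 2)) ^ (Module.finrank ℝ E / 2 : ℂ) = (c : ℂ) := by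
    rw [hc, Complex.ofReal_cpow (by positivity)]
    push_cast
    rfl
  rw [hcc, ← mul_assoc, inv_mul_cancel₀ (by exact_mod_cast hc0.ne'), one_mul, Complex.I_sq]
  congr 1
  ring

instance isOpenPosMeasure_stdGaussian (E : Type*) [NormedAddCommGroup E]
    [InnerProductSpace ℝ E] [FiniteDimensional ℝ E] [MeasurableSpace E] [BorelSpace E] :
    (stdGaussian E).IsOpenPosMeasure := by
  obtain ⟨g, hg, hg0, h⟩ := exists_stdGaussian_eq_withDensity_norm E
  rw [h]
  exact (withDensity_absolutelyContinuous' (by fun_prop) (.of_forall fun x => hg0 _)).isOpenPosMeasure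

theorem stdGaussian_absolutelyContinuous (E : Type*) [NormedAddCommGroup E]
    [InnerProductSpace ℝ E] [FiniteDimensional ℝ E] [MeasurableSpace E] [BorelSpace E] :
    stdGaussian E ≪ volume := by
  obtain ⟨g, -, -, h⟩ := exists_stdGaussian_eq_withDensity_norm E
  rw [h]
  exact withDensity_absolutelyContinuous _ _

/-- The standard Gaussian measure of a cone is its normalized solid angle. -/
theorem toSphere_preimage_cone {E : Type*} [NormedAddCommGroup E]
    [InnerProductSpace ℝ E] [FiniteDimensional ℝ E] [MeasurableSpace E] [BorelSpace E]
    [Nontrivial E] {C : Set E} (hC : MeasurableSet C)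
    (hcone : ∀ r : ℝ, 0 < r → ∀ x, r • x ∈ C ↔ x ∈ C) :
    (volume : Measure E).toSphere (Subtype.val ⁻¹' C) =
      stdGaussian E C * (volume : Measure E).toSphere univ := by
  obtain ⟨g, hg, -, h⟩ := exists_stdGaussian_eq_withDensity_norm E
  -- In polar coordinates the Gaussian mass of a cone is its spherical measure times this radial
  -- integral; the case `C = univ` eliminates `k`.
  set k : ℝ≥0∞ := ∫⁻ r : Ioi (0 : ℝ), g r ∂Measure.volumeIoiPow (Module.finrank ℝ E - 1) with hk
  have key : ∀ C : Set E, MeasurableSet C → (∀ r : ℝ, 0 < r → ∀ x, r • x ∈ C ↔ x ∈ C) →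
      stdGaussian E C = (volume : Measure E).toSphere (Subtype.val ⁻¹' C) * k := by
    intro C hC hcone
    have hCs : MeasurableSet ((Subtype.val : Metric.sphere (0 : E) 1 → E) ⁻¹' C) :=
      measurable_subtype_coe hC
    have hmp := (volume : Measure E).measurePreserving_homeomorphUnitSphereProd.lintegral_comp_emb
      (Homeomorph.measurableEmbedding _)
      (fun p => (Subtype.val ⁻¹' C).indicator (1 : Metric.sphere (0 : E) 1 → ℝ≥0∞) p.1 * g p.2)
    rw [lintegral_prod_mul (f := (Subtype.val ⁻¹' C).indicator
      (1 : Metric.sphere (0 : E) 1 → ℝ≥0∞)) (g := fun r : Ioi (0 : ℝ) => g r)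
      ((measurable_one.indicator hCs).aemeasurable)
      (hg.comp measurable_subtype_coe).aemeasurable, lintegral_indicator_one hCs] at hmp
    rw [← hmp, h, withDensity_apply _ hC, ← lintegral_indicator hC]
    conv_lhs =>
      rw [← restrict_compl_singleton (μ := (volume : Measure E)) 0,
        ← lintegral_subtype_comap (measurableSet_singleton _).compl]
    refine lintegral_congr fun x => ?_
    have hx : 0 < ‖(x : E)‖ := norm_pos_iff.2 x.2
    have := hcone ‖(x : E)‖⁻¹ (inv_pos.2 hx) x
    by_cases hxC : (x : E) ∈ C <;> simp [indicator, hxC, this]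
  have huniv := key univ .univ (by simp)
  rw [measure_univ, preimage_univ] at huniv
  rw [key C hC hcone, mul_assoc, mul_comm k, ← huniv, mul_one]

/-! ### Random planes cut by a hyperplane. -/

section GaussianSections

variable {V E F : Type*} [NormedAddCommGroup V] [InnerProductSpace ℝ V] [FiniteDimensional ℝ V]
  [MeasurableSpace V] [BorelSpace V]
  [NormedAddCommGroup E] [InnerProductSpace ℝ E] [FiniteDimensional ℝ E]
  [MeasurableSpace E] [BorelSpace E]
  [NormedAddCommGroup F] [InnerProductSpace ℝ F] [FiniteDimensional ℝ F]
  [MeasurableSpace F] [BorelSpace F]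

/-- A sum of linear images of independent standard Gaussian vectors is standard Gaussian as soon as
the adjoint of the sum is an isometry. -/
theorem stdGaussian_prod_map_eq {T : E × F → V} (hT : Measurable T) (S : V → E) (S' : V → F)
    (hinner : ∀ p v, ⟪T p, v⟫ = ⟪p.1, S v⟫ + ⟪p.2, S' v⟫)
    (hnorm : ∀ v, ‖S v‖ ^ 2 + ‖S' v‖ ^ 2 = ‖v‖ ^ 2) :
    ((stdGaussian E).prod (stdGaussian F)).map T = stdGaussian V := by
  have : IsProbabilityMeasure (((stdGaussian E).prod (stdGaussian F)).map T) :=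
    Measure.isProbabilityMeasure_map hT.aemeasurable
  refine Measure.ext_of_charFun (funext fun v => ?_)
  rw [charFun_apply, integral_map hT.aemeasurable (by fun_prop)]
  simp_rw [hinner, Complex.ofReal_add, add_mul, Complex.exp_add]
  rw [integral_prod_mul (μ := stdGaussian E) (ν := stdGaussian F)
    (fun x => Complex.exp (⟪x, S v⟫ * Complex.I)) (fun y => Complex.exp (⟪y, S' v⟫ * Complex.I)),
    ← charFun_apply, ← charFun_apply, charFun_stdGaussian, charFun_stdGaussian,
    charFun_stdGaussian, ← Complex.exp_add]
  congr 1
  have := hnorm v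
  rw [← Complex.ofReal_pow ‖v‖, ← this]
  push_cast
  ring

/-- The combination is a standard Gaussian scaled by `√(b² + a²)`, and a cone does not see a
positive scale. -/
theorem stdGaussian_prod_preimage_linearCombination {C : Set E} (hC : MeasurableSet C)
    (hcone : ∀ r : ℝ, 0 < r → ∀ x, r • x ∈ C ↔ x ∈ C) {a : ℝ} (ha : a ≠ 0) (b : ℝ) :
    ((stdGaussian E).prod (stdGaussian E)) {p | b • p.1 - a • p.2 ∈ C} = stdGaussian E C := by
  set r := √(b ^ 2 + a ^ 2) with hr
  have hr0 : 0 < r := Real.sqrt_pos.2 (by positivity)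
  have hr2 : r ^ 2 = b ^ 2 + a ^ 2 := Real.sq_sqrt (by positivity)
  have hmeas : Measurable fun p : E × E => r⁻¹ • (b • p.1 - a • p.2) := by fun_prop
  have h := stdGaussian_prod_map_eq (E := E) (F := E) hmeas
    (fun v => (r⁻¹ * b) • v) (fun v => (-(r⁻¹ * a)) • v)
    (fun p v => by
      simp only [inner_smul_left, inner_smul_right, inner_sub_left, conj_trivial]; ring)
    (fun v => by
      rw [norm_smul, norm_smul, mul_pow, mul_pow, Real.norm_eq_abs, Real.norm_eq_abs, sq_abs,
        sq_abs]
      field_simp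
      rw [hr2, mul_comm])
  rw [← h, Measure.map_apply hmeas hC, h]
  refine congrArg _ (Set.ext fun p => ?_)
  exact (hcone _ (inv_pos.2 hr0) _).symm

/-- The plane spanned by two independent standard Gaussian vectors meets a hyperplane in a uniformly
distributed line. -/
theorem stdGaussian_prod_hyperplane_section (e : E →ₗᵢ[ℝ] V) (f : V →L[ℝ] ℝ) (hf : f ≠ 0)
    (hef : ∀ w, f (e w) = 0) (hker : ∀ v, f v = 0 → v ∈ range e)
    {D : Set V} (hD : MeasurableSet D) (hcone : ∀ r : ℝ, 0 < r → ∀ x, r • x ∈ D ↔ x ∈ D) :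
    ((stdGaussian V).prod (stdGaussian V)) {p | f p.2 • p.1 - f p.1 • p.2 ∈ D} =
      stdGaussian E (e ⁻¹' D) := by
  set m : V := (InnerProductSpace.toDual ℝ V).symm f with hm
  have hfm : ∀ v, ⟪m, v⟫ = f v := fun v => InnerProductSpace.toDual_symm_apply
  have hm0 : m ≠ 0 := by simpa [hm] using hf
  have hr : 0 < ‖m‖ := norm_pos_iff.2 hm0
  set u : V := ‖m‖⁻¹ • m with hu
  have hunorm : ‖u‖ = 1 := by rw [hu, norm_smul, norm_inv, norm_norm, inv_mul_cancel₀ hr.ne']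
  have huv : ∀ v, ⟪u, v⟫ = ‖m‖⁻¹ * f v := fun v => by rw [hu, real_inner_smul_left, hfm]
  have heu : ∀ w, ⟪e w, u⟫ = 0 := fun w => by rw [real_inner_comm, huv, hef, mul_zero]
  have hfu : f u = ‖m‖ := by
    rw [hu, map_smul, ← hfm, real_inner_self_eq_norm_sq, smul_eq_mul]; field_simp
  set T : ℝ × E → V := fun p => p.1 • u + e p.2 with hT
  have hTm : Measurable T := by
    have := e.continuous
    exact Continuous.measurable (by fun_prop)
  have hdecomp : ∀ v, ∃ w, v = e w + ⟪u, v⟫ • u := by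
    intro v
    obtain ⟨w, hw⟩ := hker (v - ⟪u, v⟫ • u) (by
      rw [map_sub, map_smul, huv, hfu, smul_eq_mul]; field_simp; ring)
    exact ⟨w, by rw [hw]; abel⟩
  choose S hS using hdecomp
  have hlaw : ((stdGaussian ℝ).prod (stdGaussian E)).map T = stdGaussian V := by
    refine stdGaussian_prod_map_eq hTm (fun v => ⟪u, v⟫) S (fun p v => ?_) fun v => ?_
    · conv_lhs => rw [hS v]
      simp only [hT, inner_add_left, inner_add_right, real_inner_smul_left, real_inner_smul_right,
        e.inner_map_map, heu, real_inner_comm (e _) u, real_inner_self_eq_norm_sq, hunorm]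
      simp [mul_comm, add_comm]
    · have h := norm_add_sq_real (e (S v)) (⟪u, v⟫ • u)
      rw [← hS v, real_inner_smul_right, heu, norm_smul, hunorm, e.norm_map] at h
      rw [h, Real.norm_eq_abs, mul_one, sq_abs]; ring
  have hCm : MeasurableSet (e ⁻¹' D) := e.continuous.measurable hD
  have hCcone : ∀ r : ℝ, 0 < r → ∀ x, r • x ∈ e ⁻¹' D ↔ x ∈ e ⁻¹' D := fun r hr x => by
    simpa using hcone r hr (e x)
  have hset : MeasurableSet {p : V × V | f p.2 • p.1 - f p.1 • p.2 ∈ D} := by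
    have : Measurable fun p : V × V => f p.2 • p.1 - f p.1 • p.2 := by fun_prop
    exact this hD
  have hlaw2 : (stdGaussian V).prod (stdGaussian V) =
      (((stdGaussian ℝ).prod (stdGaussian E)).prod ((stdGaussian ℝ).prod (stdGaussian E))).map
        (Prod.map T T) := by
    rw [← Measure.map_prod_map _ _ hTm hTm, hlaw]
  -- The normal components cancel, leaving a combination of the tangential ones up to the factor
  -- `‖m‖ > 0`.
  have hpre : Prod.map T T ⁻¹' {p | f p.2 • p.1 - f p.1 • p.2 ∈ D} =
      {p : (ℝ × E) × (ℝ × E) | p.2.1 • p.1.2 - p.1.1 • p.2.2 ∈ e ⁻¹' D} := by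
    ext ⟨⟨t, w⟩, ⟨t', w'⟩⟩
    simp only [mem_preimage, mem_ofPred_eq, Prod.map_apply]
    rw [← hcone _ hr (e _)]
    simp only [hT, map_add, map_smul, hef, hfu, map_sub, smul_eq_mul, add_zero]
    refine iff_of_eq (congrArg (· ∈ D) ?_)
    module
  have hQ : MeasurableSet
      {p : (ℝ × E) × (ℝ × E) | p.2.1 • p.1.2 - p.1.1 • p.2.2 ∈ e ⁻¹' D} := by
    rw [← hpre]
    exact hTm.prodMap hTm hset
  rw [hlaw2, Measure.map_apply (hTm.prodMap hTm) hset, hpre, ← lintegral_indicator_one hQ]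
  set G : (ℝ × E) × (ℝ × E) → ℝ≥0∞ :=
    {p : (ℝ × E) × (ℝ × E) | p.2.1 • p.1.2 - p.1.1 • p.2.2 ∈ e ⁻¹' D}.indicator 1 with hG
  have hGm : Measurable G := measurable_one.indicator hQ
  have hG1 : ∀ p : ℝ × E, Measurable fun q => G (p, q) := fun p => hGm.comp (by fun_prop)
  rw [lintegral_prod _ hGm.aemeasurable, lintegral_prod _ hGm.lintegral_prod_right'.aemeasurable]
  have hne : ∀ᵐ t ∂stdGaussian ℝ, t ≠ 0 :=
    (stdGaussian_absolutelyContinuous ℝ).ae_le (Measure.ae_ne volume 0)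
  have hinner : ∀ᵐ t ∂stdGaussian ℝ,
      ∫⁻ w, ∫⁻ q, G ((t, w), q) ∂(stdGaussian ℝ).prod (stdGaussian E) ∂stdGaussian E =
        stdGaussian E (e ⁻¹' D) := by
    filter_upwards [hne] with t ht
    have hG2 : Measurable fun p : E × ℝ × E => G ((t, p.1), p.2) := hGm.comp (by fun_prop)
    simp_rw [lintegral_prod _ (hG1 _).aemeasurable]
    have hG3 : Measurable fun p : E × ℝ => ∫⁻ w', G ((t, p.1), (p.2, w')) ∂stdGaussian E :=
      Measurable.lintegral_prod_right' (f := fun p : (E × ℝ) × E => G ((t, p.1.1), (p.1.2, p.2)))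
        (hGm.comp (by fun_prop))
    rw [lintegral_lintegral_swap hG3.aemeasurable]
    -- With both normal components frozen, only independent Gaussians on `E` remain, and the
    -- probability does not depend on `t` or `t'`.
    have hslice : ∀ t' : ℝ, ∫⁻ w, ∫⁻ w', G ((t, w), (t', w')) ∂stdGaussian E ∂stdGaussian E =
        stdGaussian E (e ⁻¹' D) := by
      intro t'
      have hs : MeasurableSet {p : E × E | t' • p.1 - t • p.2 ∈ e ⁻¹' D} := by
        have : Measurable fun p : E × E => t' • p.1 - t • p.2 := by fun_prop
        exact this hCm
      rw [← stdGaussian_prod_preimage_linearCombination hCm hCcone ht t',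
        ← lintegral_indicator_one hs, lintegral_prod _ (measurable_one.indicator hs).aemeasurable]
      rfl
    simp_rw [hslice]
    simp
  rw [lintegral_congr_ae hinner]
  simp

end GaussianSections

/-! ### Facets of a simplicial cone. -/

section SimplicialCone

variable {V : Type*} [NormedAddCommGroup V] [InnerProductSpace ℝ V] [FiniteDimensional ℝ V]
  [MeasurableSpace V] [BorelSpace V]

theorem stdGaussian_eq_zero_of_ker {f : V →ₗ[ℝ] ℝ} (hf : f ≠ 0) :
    stdGaussian V {v | f v = 0} = 0 := by
  refine stdGaussian_absolutelyContinuous V (Measure.addHaar_submodule volume (LinearMap.ker f) ?_)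
  rwa [Ne, LinearMap.ker_eq_top]

/-- For almost every first vector the condition confines the second to a hyperplane. This bounds the
overlaps of the facet events. -/
theorem stdGaussian_prod_proportional_eq_zero {f g : V →ₗ[ℝ] ℝ}
    (hfg : LinearIndependent ℝ ![f, g]) :
    ((stdGaussian V).prod (stdGaussian V)) {p | f p.1 * g p.2 = g p.1 * f p.2} = 0 := by
  have hf : f ≠ 0 := hfg.ne_zero 0
  have hfc : Continuous f := f.continuous_of_finiteDimensional
  have hgc : Continuous g := g.continuous_of_finiteDimensional
  have hs : MeasurableSet {p : V × V | f p.1 * g p.2 = g p.1 * f p.2} :=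
    (isClosed_eq (by fun_prop) (by fun_prop)).measurableSet
  rw [Measure.measure_prod_null hs]
  have hne : ∀ᵐ x ∂stdGaussian V, f x ≠ 0 := by
    rw [ae_iff]
    simpa using stdGaussian_eq_zero_of_ker hf
  filter_upwards [hne] with x hx
  have hcomb : f x • g - g x • f ≠ 0 := by
    intro h
    have := LinearIndependent.pair_iff.1 hfg (-g x) (f x) (by rw [← h]; module)
    exact hx this.2
  rw [Pi.zero_apply, ← stdGaussian_eq_zero_of_ker hcomb]
  refine congrArg _ (Set.ext fun y => ?_)
  simp [sub_eq_zero]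

/-- The normalized solid angles of the facets of a simplicial cone of dimension at least three add up
to less than one. -/
theorem sum_stdGaussian_facets_lt_one {n : ℕ} (hn : 1 ≤ n) (b : Module.Basis (Fin (n + 1 + 1)) ℝ V)
    {E : Fin (n + 1 + 1) → Type*} [∀ i, NormedAddCommGroup (E i)] [∀ i, InnerProductSpace ℝ (E i)]
    [∀ i, FiniteDimensional ℝ (E i)] [∀ i, MeasurableSpace (E i)] [∀ i, BorelSpace (E i)]
    (e : ∀ i, E i →ₗᵢ[ℝ] V) (he : ∀ i w, b.coord i (e i w) = 0)
    (hker : ∀ i v, b.coord i v = 0 → v ∈ range (e i)) :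
    ∑ i, stdGaussian (E i) (e i ⁻¹' {v | ∀ j, 0 ≤ b.coord j v}) < 1 := by
  set D : Set V := {v | ∀ j, 0 ≤ b.coord j v} with hD
  have hcont : ∀ j, Continuous (b.coord j) := fun j => (b.coord j).continuous_of_finiteDimensional
  have hDc : IsClosed D := by
    rw [hD, ofPred_forall]
    exact isClosed_iInter fun j => isClosed_le continuous_const (hcont j)
  have hDcone : ∀ r : ℝ, 0 < r → ∀ x, r • x ∈ D ↔ x ∈ D := fun r hr x => by
    simp only [hD, mem_ofPred_eq, map_smul, smul_eq_mul, mul_nonneg_iff_of_pos_left hr]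
  have hcoord : ∀ i, b.coord i ≠ 0 := fun i h => by
    have := DFunLike.congr_fun h (b i)
    simp at this
  -- With `q j = (b.coord j p.1, b.coord j p.2)` in the plane, `A i` says that `det (q i, q j) ≤ 0`
  -- for every `j`.
  set A : Fin (n + 1 + 1) → Set (V × V) := fun i =>
    {p | b.coord i p.2 • p.1 - b.coord i p.1 • p.2 ∈ D} with hA
  have hAmem : ∀ i p, p ∈ A i ↔
      ∀ j, b.coord i p.1 * b.coord j p.2 ≤ b.coord i p.2 * b.coord j p.1 := fun i p => by
    simp only [hA, hD, mem_ofPred_eq, map_sub, map_smul, smul_eq_mul, sub_nonneg]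
  have hAc : ∀ i, IsClosed (A i) := fun i => by
    have := hcont i
    have hc : Continuous fun p : V × V => b.coord i p.2 • p.1 - b.coord i p.1 • p.2 := by fun_prop
    exact hDc.preimage hc
  set P := (stdGaussian V).prod (stdGaussian V) with hP
  have hprob : ∀ i, stdGaussian (E i) (e i ⁻¹' D) = P (A i) := fun i =>
    (stdGaussian_prod_hyperplane_section (e i) (LinearMap.toContinuousLinearMap (b.coord i))
      (by simpa using hcoord i) (he i) (hker i) hDc.measurableSet hDcone).symm
  -- On `A i ∩ A k` the determinants of `(q i, q k)` and `(q k, q i)` are both nonpositive, hence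
  -- zero.
  have hdisj : Pairwise (Function.onFun (AEDisjoint P) A) := by
    intro i k hik
    have hli : LinearIndependent ℝ ![b.coord i, b.coord k] := by
      rw [LinearIndependent.pair_iff]
      intro s t hst
      have h1 := DFunLike.congr_fun hst (b i)
      have h2 := DFunLike.congr_fun hst (b k)
      simp [hik, hik.symm] at h1 h2
      exact ⟨h1, h2⟩
    refine measure_mono_null ?_ (stdGaussian_prod_proportional_eq_zero hli)
    rintro p ⟨hi, hk⟩
    have h1 := (hAmem i p).1 hi k
    have h2 := (hAmem k p).1 hk i
    simp only [mem_ofPred_eq]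
    linarith
  simp_rw [hprob]
  rw [← tsum_fintype (L := .unconditional _), ← measure_iUnion₀ hdisj fun i => (hAc i).measurableSet.nullMeasurableSet]
  have hclosed : IsClosed (⋃ i, A i) := isClosed_iUnion_of_finite hAc
  -- Two vectors whose coordinate pairs positively span the plane avoid all the events `A i`.
  have hne : (⋃ i, A i)ᶜ.Nonempty := by
    obtain ⟨k, rfl⟩ : ∃ k, n = k + 1 := ⟨n - 1, by omega⟩
    -- The planar points are `(1,0)`, `(0,1)` and then copies of `(-1,-1)`; `1 ≤ n` supplies at
    -- least one copy.
    obtain ⟨x, hx0, hx1, hx2⟩ : ∃ x : Fin (k + 1 + 1 + 1) → ℝ,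
        x 0 = 1 ∧ x (Fin.succ 0) = 0 ∧ ∀ i : Fin (k + 1), x i.succ.succ = -1 :=
      ⟨Fin.cons 1 (Fin.cons 0 fun _ => -1), rfl, rfl, fun _ => rfl⟩
    obtain ⟨y, hy0, hy1, hy2⟩ : ∃ y : Fin (k + 1 + 1 + 1) → ℝ,
        y 0 = 0 ∧ y (Fin.succ 0) = 1 ∧ ∀ i : Fin (k + 1), y i.succ.succ = -1 :=
      ⟨Fin.cons 0 (Fin.cons 1 fun _ => -1), rfl, rfl, fun _ => rfl⟩
    refine ⟨(b.equivFun.symm x, b.equivFun.symm y), ?_⟩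
    have hcx : ∀ z i, b.coord i (b.equivFun.symm z) = z i := fun z i => by
      rw [Module.Basis.coord_apply, ← Module.Basis.equivFun_apply, LinearEquiv.apply_symm_apply]
    simp only [mem_compl_iff, mem_iUnion, not_exists, hAmem, hcx, not_forall, not_le]
    intro i
    -- Going round the cycle `0 → 1 → 2`, and back to `0` from any later index, each determinant
    -- equals `1`.
    refine Fin.cases ?_ (fun i => Fin.cases ?_ (fun i => ?_) i) i
    · exact ⟨Fin.succ 0, by rw [hx0, hx1, hy0, hy1]; norm_num⟩
    · exact ⟨Fin.succ (Fin.succ 0), by rw [hx1, hx2, hy1, hy2]; norm_num⟩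
    · exact ⟨0, by rw [hx0, hx2, hy0, hy2]; norm_num⟩
  have hpos : P (⋃ i, A i)ᶜ ≠ 0 := (hclosed.isOpen_compl.measure_pos P hne).ne'
  refine lt_of_le_of_ne prob_le_one fun h => hpos ?_
  rwa [prob_compl_eq_zero_iff hclosed.measurableSet]

end SimplicialCone

/-! ### From spherical simplices to cones, and the conclusion. -/

theorem toSphere_univ_eq_unitSphereVolume {E : Type*} [NormedAddCommGroup E]
    [InnerProductSpace ℝ E] [FiniteDimensional ℝ E] [MeasurableSpace E] [BorelSpace E] {n : ℕ}
    (h : Module.finrank ℝ E = n + 1) :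
    (volume : Measure E).toSphere univ = unitSphereVolume n := by
  have : Nontrivial E := Module.nontrivial_of_finrank_pos (R := ℝ) (by omega)
  rw [unitSphereVolume, Measure.toSphere_apply_univ, Measure.toSphere_apply_univ,
    InnerProductSpace.volume_ball, InnerProductSpace.volume_ball, h, finrank_euclideanSpace_fin]

theorem linearIndependent_of_not_degenerate {d m : ℕ} {B : Fin (m + 1) → SphericalSpace d}
    (hB : ¬ IsDegenerateSphericalSimplex B) :
    LinearIndependent ℝ fun i => (B i : EuclideanSpace ℝ (Fin (d + 1))) := by
  rw [linearIndependent_iff_card_le_finrank_span, Fintype.card_fin]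
  by_contra h
  exact hB ⟨Submodule.span ℝ (range fun i => (B i : EuclideanSpace ℝ (Fin (d + 1)))),
    by rw [Set.finrank] at h; omega, fun i => Submodule.subset_span ⟨i, rfl⟩⟩

/-- The linear span of the vertices of a spherical simplex. -/
abbrev vertexSpan {d m : ℕ} (v : Fin (m + 1) → SphericalSpace d) :
    Submodule ℝ (EuclideanSpace ℝ (Fin (d + 1))) :=
  Submodule.span ℝ (Set.range fun j => (v j : EuclideanSpace ℝ (Fin (d + 1))))

theorem sphericalSimplexVolume_eq {d m : ℕ} {v : Fin (m + 1) → SphericalSpace d}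
    (hv : LinearIndependent ℝ fun i => (v i : EuclideanSpace ℝ (Fin (d + 1))))
    {C : Set (vertexSpan v)} (hC : MeasurableSet C)
    (hmem : ∀ w : vertexSpan v, w ∈ C ↔ ∃ c : Fin (m + 1) → ℝ, (∀ j, 0 ≤ c j) ∧
      (w : EuclideanSpace ℝ (Fin (d + 1))) = ∑ j, c j • (v j : EuclideanSpace ℝ (Fin (d + 1)))) :
    sphericalSimplexVolume v = stdGaussian (vertexSpan v) C * unitSphereVolume m := by
  have hdim : Module.finrank ℝ (vertexSpan v) = m + 1 := by
    rw [finrank_span_eq_card hv, Fintype.card_fin]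
  have : Nontrivial (vertexSpan v) := Module.nontrivial_of_finrank_pos (R := ℝ) (by omega)
  have hcone : ∀ r : ℝ, 0 < r → ∀ x, r • x ∈ C ↔ x ∈ C := by
    have hmul : ∀ r : ℝ, 0 < r → ∀ x, x ∈ C → r • x ∈ C := by
      intro r hr x hx
      obtain ⟨c, hc, hxc⟩ := (hmem x).1 hx
      refine (hmem _).2 ⟨fun j => r * c j, fun j => mul_nonneg hr.le (hc j), ?_⟩
      rw [Submodule.coe_smul, hxc, Finset.smul_sum]
      simp_rw [smul_smul]
    refine fun r hr x => ⟨fun h => ?_, hmul r hr x⟩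
    simpa [smul_smul, inv_mul_cancel₀ hr.ne'] using hmul r⁻¹ (inv_pos.2 hr) _ h
  rw [← toSphere_univ_eq_unitSphereVolume hdim, ← toSphere_preimage_cone hC hcone,
    sphericalSimplexVolume]
  refine congrArg _ (Set.ext fun x => ?_)
  rw [mem_preimage, hmem]
  constructor
  · rintro ⟨y, ⟨c, hc, hyc⟩, hyx⟩
    exact ⟨c, hc, by rw [← hyx, hyc]⟩
  · rintro ⟨c, hc, hxc⟩
    exact ⟨⟨x, mem_sphere_zero_iff_norm.2 (mem_sphere_zero_iff_norm.1 x.2)⟩, ⟨c, hc, hxc⟩, rfl⟩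

theorem theorem2p1 (n d : ℕ) (hn : 1 ≤ n) (hd : n + 1 ≤ d)
    (B : Fin (n + 1 + 1) → SphericalSpace d)
    (hB : ¬ IsDegenerateSphericalSimplex B) :
    ∑ i : Fin (n + 1 + 1), sphericalSimplexVolume (faceVertices B i) < unitSphereVolume n := by
  have hli := linearIndependent_of_not_degenerate hB
  set b : Module.Basis (Fin (n + 1 + 1)) ℝ (vertexSpan B) := Module.Basis.span hli with hb
  have hbB : ∀ i, (b i : EuclideanSpace ℝ (Fin (d + 1))) = B i := fun i => by
    rw [hb, Module.Basis.span_apply]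
  have hbsum : ∀ x : vertexSpan B, (x : EuclideanSpace ℝ (Fin (d + 1))) =
      ∑ j, b.coord j x • (B j : EuclideanSpace ℝ (Fin (d + 1))) := fun x => by
    conv_lhs => rw [← b.sum_repr x]
    simp_rw [Submodule.coe_sum, Submodule.coe_smul, hbB, Module.Basis.coord_apply]
  have hcoord : ∀ (x : vertexSpan B) (c : Fin (n + 1 + 1) → ℝ),
      (x : EuclideanSpace ℝ (Fin (d + 1))) =
        ∑ j, c j • (B j : EuclideanSpace ℝ (Fin (d + 1))) → ∀ j, b.coord j x = c j := by
    intro x c hxc j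
    have : x = ∑ j, c j • b j := Subtype.ext (by
      simp_rw [hxc, Submodule.coe_sum, Submodule.coe_smul, hbB])
    rw [this, Module.Basis.coord_apply, b.repr_sum_self]
  have hle : ∀ i, vertexSpan (faceVertices B i) ≤ vertexSpan B := fun i =>
    Submodule.span_mono (range_subset_iff.2 fun j => ⟨i.succAbove j, rfl⟩)
  set e : ∀ i, vertexSpan (faceVertices B i) →ₗᵢ[ℝ] vertexSpan B := fun i =>
    ⟨Submodule.inclusion (hle i), fun _ => rfl⟩ with he
  have hcoe : ∀ i w, (e i w : EuclideanSpace ℝ (Fin (d + 1))) = w := fun i w => rfl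
  have hface : ∀ i (w : vertexSpan (faceVertices B i)), ∃ c : Fin (n + 1) → ℝ,
      (w : EuclideanSpace ℝ (Fin (d + 1))) = ∑ j, c j • (faceVertices B i j).1 := fun i w => by
    obtain ⟨c, hc⟩ := (Submodule.mem_span_range_iff_exists_fun ℝ).1 w.2
    exact ⟨c, hc.symm⟩
  -- Coordinates in the face basis become coordinates in `b` by inserting `0` at position `i`.
  have hcoordface : ∀ i (w : vertexSpan (faceVertices B i)) (c : Fin (n + 1) → ℝ),
      (w : EuclideanSpace ℝ (Fin (d + 1))) = ∑ j, c j • (faceVertices B i j).1 →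
        ∀ j, b.coord j (e i w) = i.insertNth (α := fun _ => ℝ) 0 c j := by
    intro i w c hwc
    refine hcoord _ _ ?_
    rw [hcoe, hwc, Fin.sum_univ_succAbove _ i]
    simp [faceVertices]
  have hzero : ∀ i w, b.coord i (e i w) = 0 := fun i w => by
    obtain ⟨c, hc⟩ := hface i w
    rw [hcoordface i w c hc, Fin.insertNth_apply_same]
  have hker : ∀ i v, b.coord i v = 0 → v ∈ range (e i) := by
    intro i v hv
    have hvsum := hbsum v
    rw [Fin.sum_univ_succAbove _ i, hv, zero_smul, zero_add] at hvsum
    refine ⟨⟨v, ?_⟩, rfl⟩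
    rw [hvsum]
    exact Submodule.sum_mem _ fun j _ => Submodule.smul_mem _ _ (Submodule.subset_span ⟨j, rfl⟩)
  have hsum := sum_stdGaussian_facets_lt_one hn b e hzero hker
  have hvol : ∀ i, sphericalSimplexVolume (faceVertices B i) =
      stdGaussian (vertexSpan (faceVertices B i)) (e i ⁻¹' {v | ∀ j, 0 ≤ b.coord j v}) *
        unitSphereVolume n := by
    intro i
    refine sphericalSimplexVolume_eq (hli.comp _ (Fin.succAbove_right_injective (p := i))) ?_ ?_
    · rw [ofPred_forall, preimage_iInter]
      exact (isClosed_iInter fun j => isClosed_le continuous_const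
        (((b.coord j).continuous_of_finiteDimensional).comp (e i).continuous)).measurableSet
    · intro w
      constructor
      · intro hw
        obtain ⟨c, hc⟩ := hface i w
        refine ⟨c, fun j => ?_, hc⟩
        have := hw (i.succAbove j)
        rwa [hcoordface i w c hc, Fin.insertNth_apply_succAbove] at this
      · rintro ⟨c, hc, hwc⟩ j
        rw [hcoordface i w c hwc]
        refine Fin.succAboveCases i ?_ (fun j => ?_) j
        · simp
        · simpa using hc j
  have hU : unitSphereVolume n ≠ 0 := by
    rw [unitSphereVolume, Ne, Measure.measure_univ_eq_zero]
    exact Measure.toSphere_ne_zero _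
  have hU' : unitSphereVolume n ≠ ∞ := measure_ne_top _ _
  simp_rw [hvol]
  rw [← Finset.sum_mul]
  calc _ < 1 * unitSphereVolume n := (ENNReal.mul_lt_mul_iff_left hU hU').2 hsum
    _ = _ := one_mul _
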